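/- Theorem 1 ($k$-NN regression rate). Let $D\ge 1$, let $\mathcal X\subseteq\mathbb R^D$ be compact and let $f:\mathcal X\to\mathbb R$ be any function (no continuity is assumed). For $x\in\mathcal X$ and $r\ge 0$ let $B(x,r)=\{x'\in\mathcal X:|x-x'|\le r\}$, and let $$u_f(x,r)=\sup_{x'\in B(x,r)}|f(x)-f(x')|\in[0,\infty].$$ Let $v_D$ be the volume of the unit ball of $\mathbb R^D$. Assume: (1) there are $\gamma>0$ and $r_0>0$ such that, for all $x\in\mathcal X$ and $0<r<r_0$, $\mathrm{Vol}(\mathcal X\cap\{x':|x-x'|\le r\})\ge\gamma\,\mathrm{Vol}(\{x'\in\mathbb R^D:|x-x'|\le r\})$; (2) $p_X$ is a probability density on $\mathbb R^D$ with $\{p_X\neq 0\}=\mathcal X$ and $p_{X,0}:=\inf_{x\in\mathcal X}p_X(x)>0$; (3) $\xi$ is a real random variable with $\mathbb E[\xi]=0$ and, for some $\sigma\ge 0$, $\mathbb E[e^{\lambda\xi}]\le e^{\sigma^2\lambda^2/2}$ for all $\lambda\in\mathbb R$. Let $x_1,\dots,x_n\in\mathcal X$ be i.i.d. with density $p_X$,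 let $\xi_1,\dots,\xi_n$ be i.i.d. copies of $\xi$, independent of $(x_1,\dots,x_n)$, and let $y_i=f(x_i)+\xi_i$. Put $X=\{x_1,\dots,x_n\}$ and, for an integer $k\ge 1$ and $x\in\mathcal X$, $$r_k(x)=\inf\{r:|B(x,r)\cap X|\ge k\},\qquad N_k(x)=B(x,r_k(x))\cap X,\qquad f_k(x)=\frac1{|N_k(x)|}\sum_{i=1}^n y_i\,\mathbf 1[x_i\in N_k(x)].$$ Let $0<\delta<1$. If $$2^8\,D\,\log^2(4/\delta)\,\log n\ \le\ k\ \le\ \tfrac12\,\gamma\,p_{X,0}\,v_D\,r_0^D\,n,$$ then, with probability at least $1-\delta$, for all $x\in\mathcal X$ simultaneously, $$|f(x)-f_k(x)|\ \le\ u_f\!\left(x,\Big(\frac{2k}{\gamma\,p_{X,0}\,v_D\,n}\Big)^{1/D}\right)+2\sigma\sqrt{\frac{D\log n+\log(2/\delta)}{k}}.$$ -/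

import Mathlib

open MeasureTheory ProbabilityTheory
open scoped ENNReal NNReal

namespace KNN

/-- Support regularity with constants `γ` and `r₀`: `Vol (𝒳 ∩ B(x, r)) ≥ γ * Vol (B(x, r))` for all
`x ∈ 𝒳` and `0 < r < r₀`, where `B(x, r)` is the closed Euclidean ball. -/
def SupportRegular {D : ℕ} (𝒳 : Set (EuclideanSpace ℝ (Fin D))) (γ r₀ : ℝ) : Prop :=
  0 < γ ∧ 0 < r₀ ∧ ∀ x ∈ 𝒳, ∀ r : ℝ, 0 < r → r < r₀ →
    ENNReal.ofReal γ * volume (Metric.closedBall x r) ≤ volume (𝒳 ∩ Metric.closedBall x r)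

/-- `p` is a probability density with support `𝒳`. -/
structure IsDensityWithSupport {D : ℕ} (p : EuclideanSpace ℝ (Fin D) → ℝ)
    (𝒳 : Set (EuclideanSpace ℝ (Fin D))) : Prop where
  measurable : Measurable p
  nonneg : ∀ x, 0 ≤ p x
  support_eq : Function.support p = 𝒳
  lintegral_eq_one : ∫⁻ x, ENNReal.ofReal (p x) = 1

/-- The probability measure with density `p`. -/
noncomputable def densityMeasure {D : ℕ} (p : EuclideanSpace ℝ (Fin D) → ℝ) :
    Measure (EuclideanSpace ℝ (Fin D)) :=
  volume.withDensity fun x => ENNReal.ofReal (p x)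

/-- `p_{X,0} = inf_{x ∈ 𝒳} p x`. -/
noncomputable def densityInf {D : ℕ} (p : EuclideanSpace ℝ (Fin D) → ℝ)
    (𝒳 : Set (EuclideanSpace ℝ (Fin D))) : ℝ :=
  sInf (p '' 𝒳)

/-- The law `ν` on `ℝ` has mean zero and is sub-Gaussian with parameter `σ ^ 2`, that is,
`E[exp (t ξ)] ≤ exp (σ ^ 2 * t ^ 2 / 2)` for all real `t`, with `exp (t ξ)` integrable. -/
def SubGaussianNoise (ν : Measure ℝ) (σ : ℝ≥0) : Prop :=
  ∫ z, z ∂ν = 0 ∧ HasSubgaussianMGF (fun z : ℝ => z) (σ ^ 2) ν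

/-- `v_D`, the volume of the unit ball of `ℝ^D`. -/
noncomputable def unitBallVolume (D : ℕ) : ℝ :=
  (volume (Metric.closedBall (0 : EuclideanSpace ℝ (Fin D)) 1)).toReal

section Estimator

variable {M : Type*} [PseudoMetricSpace M] {n : ℕ}

/-- The `k`-NN radius `r_k(x) = inf {r : |B(x, r) ∩ X| ≥ k}` for the sample `X = {s 1, …, s n}`.
In the theorem `M` is the subspace `𝒳`, so `Metric.closedBall x r = {x' ∈ 𝒳 : |x - x'| ≤ r}`. -/
noncomputable def kNNRadius (s : Fin n → M) (k : ℕ) (x : M) : ℝ :=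
  sInf {r : ℝ | k ≤ (Metric.closedBall x r ∩ Set.range s).ncard}

/-- The `k`-NN set `N_k(x) = B(x, r_k(x)) ∩ X`. -/
def kNNSet (s : Fin n → M) (k : ℕ) (x : M) : Set M :=
  Metric.closedBall x (kNNRadius s k x) ∩ Set.range s

open Classical in
/-- The `k`-NN regression function `f_k` of the data `(s i, y i)`. -/
noncomputable def kNNRegression (s : Fin n → M) (y : Fin n → ℝ) (k : ℕ) (x : M) : ℝ :=
  1 / ((kNNSet s k x).ncard : ℝ) * ∑ i, y i * (if s i ∈ kNNSet s k x then 1 else 0)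

/-- The pointwise modulus of continuity `u_f(x, r) = sup_{x' ∈ B(x, r)} |f x - f x'|`, with values
in `[0, ∞]` because `f` need not be bounded. -/
noncomputable def modulus (f : M → ℝ) (x : M) (r : ℝ) : ℝ≥0∞ :=
  ⨆ x' ∈ Metric.closedBall x r, ENNReal.ofReal |f x - f x'|

end Estimator

end KNN

/-!
Almost surely the design points are distinct, and then `N_k(x)` is the trace on the sample of a ball
around `x`. The error at `x` is at most a bias, bounded by `u_f(x, r_k(x))`, plus the absolute value
of the average of the noise over `N_k(x)`.

* Radius: a ball of radius `R = (2 * k / (γ * p_{X,0} * v_D * n)) ^ (1 / D)` has mass at least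
  `2 * k / n`, and still at least `3 * k / (2 * n)` after shrinking its radius by the factor
  `1 - 1 / (4 * D)`. By a Chernoff bound over the points of an `R / (4 * D)`-net, all balls of
  radius `R` capture at least `k` design points, that is, `r_k ≤ R` everywhere.
* Noise: by Radon's theorem the balls of `ℝ^D` have Vapnik-Chervonenkis dimension at most `D + 1`,
  so by the Sauer-Shelah lemma they cut at most `n ^ (2 * D)` subsets out of the sample. As the
  noise is independent of the design, a union bound over these subsets controls all averages.
-/

namespace KNN

section BallTrace

open Finset Metric
open scoped Topology

variable {ι M : Type*} [Fintype ι] [PseudoMetricSpace M]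

open Classical in
/-- The trace of the closed ball `B(c, r)` on the sample `s`, recorded as a set of indices so that
it makes sense for samples with repeated points. -/
noncomputable def ballTrace (s : ι → M) (c : M) (r : ℝ) : Finset ι :=
  {i | s i ∈ closedBall c r}

@[simp]
theorem mem_ballTrace {s : ι → M} {c : M} {r : ℝ} {i : ι} :
    i ∈ ballTrace s c r ↔ dist (s i) c ≤ r := by
  simp [ballTrace]

theorem ballTrace_mono (s : ι → M) (c : M) : Monotone (ballTrace s c) :=
  fun _ _ hr _ hi => mem_ballTrace.2 ((mem_ballTrace.1 hi).trans hr)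

theorem exists_gt_ballTrace_eq (s : ι → M) (c : M) (r : ℝ) :
    ∃ ρ > r, ballTrace s c ρ = ballTrace s c r := by
  have hev : ∀ᶠ ρ in 𝓝[>] r, ∀ i, r < dist (s i) c → ρ < dist (s i) c :=
    Filter.eventually_all.2 fun _ => Filter.eventually_imp_distrib_left.2 fun hi =>
      nhdsWithin_le_nhds (eventually_lt_nhds hi)
  obtain ⟨ρ, hρ, hrρ⟩ := (hev.and self_mem_nhdsWithin).exists
  refine ⟨ρ, hrρ, (ballTrace_mono s c (le_of_lt hrρ)).antisymm' fun i hi => ?_⟩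
  by_contra hir
  exact (hρ i (by simpa using hir)).not_ge (mem_ballTrace.1 hi)

theorem ncard_closedBall_inter_range {s : ι → M} (hs : Function.Injective s) (c : M) (r : ℝ) :
    (closedBall c r ∩ Set.range s).ncard = #(ballTrace s c r) := by
  rw [← Set.ncard_coe_finset, ← Set.ncard_image_of_injective _ hs, Set.inter_comm,
    ← Set.image_preimage_eq_range_inter]
  congr 2
  ext i
  simp

open Classical in
/-- The family of index sets that closed balls cut out of the sample `s`. Whatever the query point,
the `k`-NN estimator averages over a member of this family. -/
noncomputable def ballTraces (s : ι → M) : Finset (Finset ι) :=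
  {S | ∃ c r, ballTrace s c r = S}

@[simp]
theorem mem_ballTraces {s : ι → M} {S : Finset ι} :
    S ∈ ballTraces s ↔ ∃ c r, ballTrace s c r = S := by
  simp [ballTraces]

theorem mem_ballTraces_iff_exists_gap {s : ι → M} {S : Finset ι} :
    S ∈ ballTraces s ↔
      ∃ c r, (∀ i ∈ S, dist (s i) c < r) ∧ ∀ i ∈ (S : Set ι)ᶜ, r < dist (s i) c := by
  rw [mem_ballTraces]
  refine exists_congr fun c => ⟨?_, ?_⟩
  · rintro ⟨r, rfl⟩
    obtain ⟨ρ, hrρ, hρ⟩ := exists_gt_ballTrace_eq s c r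
    obtain ⟨t, hrt, htρ⟩ := exists_between hrρ
    refine ⟨t, fun i hi => (mem_ballTrace.1 hi).trans_lt hrt, fun i hi => htρ.trans ?_⟩
    simpa [← hρ] using hi
  · rintro ⟨r, hlt, hgt⟩
    refine ⟨r, Finset.ext fun i => ?_⟩
    by_cases hi : i ∈ S
    · simp [hi, (hlt i hi).le]
    · simp [hi, hgt i hi]

theorem isOpen_setOf_mem_ballTraces (S : Finset ι) : IsOpen {s : ι → M | S ∈ ballTraces s} := by
  simp only [mem_ballTraces_iff_exists_gap, Set.ofPred_exists, Set.ofPred_and, Set.ofPred_forall]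
  refine isOpen_iUnion fun c => isOpen_iUnion fun r => IsOpen.inter ?_ ?_
  · exact isOpen_biInter_finset fun i _ => isOpen_lt (by fun_prop) continuous_const
  · exact (Set.toFinite _).isOpen_biInter fun i _ => isOpen_lt continuous_const (by fun_prop)

end BallTrace

section VCDimension

open Finset Metric

/-- The closed balls of `M` have Vapnik-Chervonenkis dimension at most `v`: they shatter no set of
more than `v` points. This is expressed through the traces on finite samples, whose number it bounds
polynomially in the sample size. -/
def BallVCDimLE (M : Type*) [PseudoMetricSpace M] (v : ℕ) : Prop :=
  ∀ ⦃n : ℕ⦄ (s : Fin n → M), (ballTraces s).vcDim ≤ v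

theorem BallVCDimLE.mono {M : Type*} [PseudoMetricSpace M] {v w : ℕ} (hM : BallVCDimLE M v)
    (hvw : v ≤ w) : BallVCDimLE M w :=
  fun _ s => (hM s).trans hvw

theorem ballTraces_comp_coe_subset {ι M : Type*} [Fintype ι] [PseudoMetricSpace M] {K : Set M}
    (s : ι → K) : ballTraces s ⊆ ballTraces fun i => (s i : M) := by
  intro S hS
  obtain ⟨c, r, rfl⟩ := mem_ballTraces.1 hS
  exact mem_ballTraces.2 ⟨c, r, by ext i; simp [Subtype.dist_eq]⟩

theorem BallVCDimLE.subtype {M : Type*} [PseudoMetricSpace M] {v : ℕ} (hM : BallVCDimLE M v)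
    (K : Set M) : BallVCDimLE K v :=
  fun _ s => (vcDim_mono (ballTraces_comp_coe_subset s)).trans (hM _)

theorem sum_range_choose_le_pow {n v : ℕ} (hn : 2 ≤ n) (hv : 2 ≤ v) :
    ∑ i ∈ range (v + 1), n.choose i ≤ n ^ v := by
  induction v, hv using Nat.le_induction with
  | base =>
    have htri : n.choose 2 * 2 = n * (n - 1) := by
      rw [Nat.choose_two_right, Nat.div_mul_cancel (Nat.even_mul_pred_self n).two_dvd]
    obtain ⟨m, rfl⟩ := Nat.exists_eq_add_of_le' hn
    simp only [sum_range_succ, range_zero, sum_empty, Nat.choose_zero_right, Nat.choose_one_right]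
    replace htri : (m + 2).choose 2 * 2 = (m + 2) * (m + 1) := by simpa using htri
    nlinarith
  | succ v hv ih =>
    have hchoose : n.choose (v + 1) * 2 ≤ n ^ (v + 1) :=
      calc n.choose (v + 1) * 2 ≤ n.choose (v + 1) * (v + 1).factorial := by
            gcongr
            exact (Nat.self_le_factorial _).trans' (by omega)
        _ = n.descFactorial (v + 1) := by rw [mul_comm, Nat.descFactorial_eq_factorial_mul_choose]
        _ ≤ n ^ (v + 1) := Nat.descFactorial_le_pow _ _
    have hpow : n ^ v * 2 ≤ n ^ (v + 1) := by rw [pow_succ]; gcongr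
    rw [sum_range_succ]
    omega

theorem BallVCDimLE.card_ballTraces_le {M : Type*} [PseudoMetricSpace M] {n v : ℕ}
    (hM : BallVCDimLE M v) (hn : 2 ≤ n) (hv : 2 ≤ v) (s : Fin n → M) :
    #(ballTraces s) ≤ n ^ v :=
  calc #(ballTraces s) ≤ #(ballTraces s).shatterer := card_le_card_shatterer _
    _ ≤ ∑ i ∈ Iic (ballTraces s).vcDim, n.choose i := by
      simpa using card_shatterer_le_sum_vcDim (𝒜 := ballTraces s)
    _ ≤ ∑ i ∈ range (v + 1), n.choose i := by
      refine sum_le_sum_of_subset fun i hi => ?_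
      exact mem_range.2 (Nat.lt_succ_of_le ((mem_Iic.1 hi).trans (hM s)))
    _ ≤ n ^ v := sum_range_choose_le_pow hn hv

variable {E : Type*} [NormedAddCommGroup E] [InnerProductSpace ℝ E]

theorem exists_linearMap_eq_dist_sq_sub_dist_sq (c₁ c₂ : E) :
    ∃ (ℓ : E →ₗ[ℝ] ℝ) (κ : ℝ), ∀ y, dist y c₁ ^ 2 - dist y c₂ ^ 2 = ℓ y + κ := by
  refine ⟨(2 : ℝ) • innerₛₗ ℝ (c₂ - c₁), ‖c₁‖ ^ 2 - ‖c₂‖ ^ 2, fun y => ?_⟩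
  simp only [dist_eq_norm, norm_sub_sq_real, real_inner_comm y, LinearMap.smul_apply,
    innerₛₗ_apply_apply, inner_sub_right, smul_eq_mul]
  ring

theorem disjoint_convexHull_closedBall_sdiff (c₁ c₂ : E) (r₁ r₂ : ℝ) :
    Disjoint (convexHull ℝ (closedBall c₁ r₁ \ closedBall c₂ r₂))
      (convexHull ℝ (closedBall c₂ r₂ \ closedBall c₁ r₁)) := by
  rcases lt_or_ge r₁ 0 with hr₁ | hr₁
  · simp [closedBall_eq_empty.2 hr₁]
  rcases lt_or_ge r₂ 0 with hr₂ | hr₂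
  · simp [closedBall_eq_empty.2 hr₂]
  obtain ⟨ℓ, κ, hℓ⟩ := exists_linearMap_eq_dist_sq_sub_dist_sq c₁ c₂
  have hleft : convexHull ℝ (closedBall c₁ r₁ \ closedBall c₂ r₂) ⊆
      {y | ℓ y < r₁ ^ 2 - r₂ ^ 2 - κ} := by
    refine convexHull_min (fun y hy => ?_) (convex_halfSpace_lt ℓ.isLinear _)
    have hin : dist y c₁ ^ 2 ≤ r₁ ^ 2 := pow_le_pow_left₀ dist_nonneg hy.1 2
    have hout : r₂ ^ 2 < dist y c₂ ^ 2 := pow_lt_pow_left₀ (not_le.1 hy.2) hr₂ two_ne_zero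
    exact Set.mem_ofPred.2 (by linarith [hℓ y])
  have hright : convexHull ℝ (closedBall c₂ r₂ \ closedBall c₁ r₁) ⊆
      {y | r₁ ^ 2 - r₂ ^ 2 - κ < ℓ y} := by
    refine convexHull_min (fun y hy => ?_) (convex_halfSpace_gt ℓ.isLinear _)
    have hin : dist y c₂ ^ 2 ≤ r₂ ^ 2 := pow_le_pow_left₀ dist_nonneg hy.1 2
    have hout : r₁ ^ 2 < dist y c₁ ^ 2 := pow_lt_pow_left₀ (not_le.1 hy.2) hr₁ two_ne_zero
    exact Set.mem_ofPred.2 (by linarith [hℓ y])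
  exact Set.disjoint_left.2 fun y hy hy' =>
    lt_asymm (Set.mem_ofPred.1 (hleft hy)) (Set.mem_ofPred.1 (hright hy'))

theorem affineIndependent_of_shatters_ballTraces {ι : Type*} [Fintype ι] [DecidableEq ι]
    {s : ι → E} {T : Finset ι} (hT : (ballTraces s).Shatters T) :
    AffineIndependent ℝ fun i : T => s i := by
  classical
  by_contra hdep
  obtain ⟨I, hI⟩ := Convex.radon_partition hdep
  have htrace : ∀ J : Set T, ∃ c r, ∀ i : T, dist (s i) c ≤ r ↔ i ∈ J := by
    intro J
    have hJ : ({i | i ∈ J} : Finset T).map (.subtype _) ⊆ T := fun i hi => by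
      obtain ⟨j, -, rfl⟩ := mem_map.1 hi
      exact j.2
    obtain ⟨u, hu, huJ⟩ := hT hJ
    obtain ⟨c, r, rfl⟩ := mem_ballTraces.1 hu
    exact ⟨c, r, fun i => by simpa using Finset.ext_iff.1 huJ i⟩
  obtain ⟨c₁, r₁, h₁⟩ := htrace I
  obtain ⟨c₂, r₂, h₂⟩ := htrace Iᶜ
  refine Set.not_disjoint_iff_nonempty_inter.2 hI
    ((disjoint_convexHull_closedBall_sdiff c₁ c₂ r₁ r₂).mono (convexHull_mono ?_)
      (convexHull_mono ?_))
  · rintro _ ⟨i, hi, rfl⟩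
    exact ⟨(h₁ i).2 hi, fun h => (h₂ i).1 h hi⟩
  · rintro _ ⟨i, hi, rfl⟩
    exact ⟨(h₂ i).2 hi, fun h => hi ((h₁ i).1 h)⟩

theorem ballVCDimLE_finrank_add_one [FiniteDimensional ℝ E] :
    BallVCDimLE E (Module.finrank ℝ E + 1) := by
  refine fun n s => Finset.sup_le fun T hT => ?_
  have hind := affineIndependent_of_shatters_ballTraces (mem_shatterer.1 hT)
  simpa using hind.card_le_finrank_succ.trans
    (Nat.add_le_add_right (Submodule.finrank_le (vectorSpan ℝ _)) 1)

end VCDimension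

section Regression

open Finset Metric

variable {M : Type*} [PseudoMetricSpace M] {n k : ℕ} {s : Fin n → M} {z : M} {r : ℝ}

theorem kNNRadius_le (hs : Function.Injective s) (hk : 1 ≤ k) (hr : k ≤ #(ballTrace s z r)) :
    kNNRadius s k z ≤ r := by
  refine csInf_le ⟨0, fun ρ (hρ : k ≤ _) => ?_⟩
    (hr.trans_eq (ncard_closedBall_inter_range hs z r).symm)
  by_contra! hneg
  simp [closedBall_eq_empty.2 hneg] at hρ
  omega

theorem le_card_ballTrace_kNNRadius (hs : Function.Injective s) (hr : k ≤ #(ballTrace s z r)) :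
    k ≤ #(ballTrace s z (kNNRadius s k z)) := by
  obtain ⟨ρ, hRρ, hρ⟩ := exists_gt_ballTrace_eq s z (kNNRadius s k z)
  obtain ⟨t, ht, htρ⟩ :=
    exists_lt_of_csInf_lt ⟨r, hr.trans_eq (ncard_closedBall_inter_range hs z r).symm⟩ hRρ
  calc k ≤ #(ballTrace s z t) := ht.trans_eq (ncard_closedBall_inter_range hs z t)
    _ ≤ #(ballTrace s z ρ) := card_le_card (ballTrace_mono s z htρ.le)
    _ = #(ballTrace s z (kNNRadius s k z)) := by rw [hρ]

theorem kNNRegression_eq_inv_mul_sum (hs : Function.Injective s) (y : Fin n → ℝ) (k : ℕ) (z : M) :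
    kNNRegression s y k z = (#(ballTrace s z (kNNRadius s k z)) : ℝ)⁻¹ *
      ∑ i ∈ ballTrace s z (kNNRadius s k z), y i := by
  simp [kNNRegression, kNNSet, ncard_closedBall_inter_range hs, ballTrace, sum_filter]

theorem abs_sub_le_toReal_modulus {f : M → ℝ} {z' : M} (hf : modulus f z r ≠ ⊤)
    (hz' : z' ∈ closedBall z r) : |f z - f z'| ≤ (modulus f z r).toReal :=
  (ENNReal.ofReal_le_iff_le_toReal hf).1
    (le_iSup₂ (f := fun x' _ => ENNReal.ofReal |f z - f x'|) z' hz')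

theorem abs_sub_inv_mul_sum_add_le {ι : Type*} {S : Finset ι} (hS : S.Nonempty) {a b t : ℝ}
    {g e : ι → ℝ} (hg : ∀ i ∈ S, |a - g i| ≤ b) (he : |∑ i ∈ S, e i| ≤ #S * t) :
    |a - (#S : ℝ)⁻¹ * ∑ i ∈ S, (g i + e i)| ≤ b + t := by
  have hpos : (0 : ℝ) < #S := by exact_mod_cast hS.card_pos
  have hsplit : a - (#S : ℝ)⁻¹ * ∑ i ∈ S, (g i + e i) =
      (#S : ℝ)⁻¹ * (∑ i ∈ S, (a - g i) - ∑ i ∈ S, e i) := by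
    rw [sum_add_distrib, sum_sub_distrib, sum_const, nsmul_eq_mul]
    field_simp
    ring
  have hbias : |∑ i ∈ S, (a - g i)| ≤ #S * b :=
    (abs_sum_le_sum_abs _ _).trans ((sum_le_card_nsmul _ _ _ hg).trans_eq (nsmul_eq_mul _ _))
  rw [hsplit, abs_mul, abs_of_pos (inv_pos.2 hpos), inv_mul_le_iff₀ hpos, mul_add]
  exact (abs_sub _ _).trans (add_le_add hbias he)

theorem ofReal_abs_sub_kNNRegression_le (hs : Function.Injective s) (hk : 1 ≤ k) {f : M → ℝ}
    {y e : Fin n → ℝ} (hy : ∀ i, y i = f (s i) + e i) {t : ℝ} (ht : 0 ≤ t)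
    (hr : k ≤ #(ballTrace s z r))
    (he : ∀ S ∈ ballTraces s, k ≤ #S → |∑ i ∈ S, e i| ≤ #S * t) :
    ENNReal.ofReal |f z - kNNRegression s y k z| ≤ modulus f z r + ENNReal.ofReal t := by
  rcases eq_or_ne (modulus f z r) ⊤ with htop | htop
  · simp [htop]
  have hcard := le_card_ballTrace_kNNRadius hs hr
  have hmem : ∀ i ∈ ballTrace s z (kNNRadius s k z), s i ∈ closedBall z r := fun i hi =>
    (mem_ballTrace.1 hi).trans (kNNRadius_le hs hk hr)
  rw [← ENNReal.ofReal_toReal htop, ← ENNReal.ofReal_add ENNReal.toReal_nonneg ht,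
    kNNRegression_eq_inv_mul_sum hs, funext hy]
  exact ENNReal.ofReal_le_ofReal <| abs_sub_inv_mul_sum_add_le (card_pos.1 (hk.trans hcard))
    (fun i hi => abs_sub_le_toReal_modulus htop (hmem i hi))
    (he _ (mem_ballTraces.2 ⟨z, _, rfl⟩) hcard)

end Regression

section Independence

open Finset

variable {Ω ι E : Type*} [MeasurableSpace Ω] {P : Measure Ω} [MeasurableSpace E]

theorem ae_ne_of_indepFun [MeasurableEq E] [IsFiniteMeasure P] {X Y : Ω → E} (hX : Measurable X)
    (hY : Measurable Y) (hXY : IndepFun X Y P) [NullSingletonClass (P.map Y)] :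
    ∀ᵐ ω ∂P, X ω ≠ Y ω := by
  have hdiag : MeasurableSet (Set.diagonal E) := measurableSet_diagonal
  have hnull : (P.map fun ω => (X ω, Y ω)) (Set.diagonal E) = 0 := by
    rw [(indepFun_iff_map_prod_eq_prod_map_map hX.aemeasurable hY.aemeasurable).1 hXY,
      Measure.measure_prod_null hdiag]
    refine .of_forall fun a => ?_
    have hfiber : Prod.mk a ⁻¹' Set.diagonal E = {a} := by ext b; simp [eq_comm]
    simp [hfiber]
  rw [Measure.map_apply (hX.prodMk hY) hdiag] at hnull
  exact measure_eq_zero_iff_ae_notMem.1 hnull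

theorem ae_injective_of_iIndepFun [MeasurableEq E] [Countable ι] {x : ι → Ω → E}
    (hx : ∀ i, Measurable (x i)) (hindep : iIndepFun x P)
    (hatom : ∀ i, NullSingletonClass (P.map (x i))) :
    ∀ᵐ ω ∂P, Function.Injective fun i => x i ω := by
  have := hindep.isProbabilityMeasure
  have hne : ∀ᵐ ω ∂P, ∀ i j, i ≠ j → x i ω ≠ x j ω := by
    simp only [ae_all_iff]
    intro i j hij
    have := hatom j
    exact ae_ne_of_indepFun (hx i) (hx j) (hindep.indepFun hij)
  filter_upwards [hne] with ω hω i j hij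
  exact not_imp_not.1 (hω i j) hij

theorem iIndepSet_preimage {x : ι → Ω → E} (hx : ∀ i, Measurable (x i)) (hindep : iIndepFun x P)
    {B : ι → Set E} (hB : ∀ i, MeasurableSet (B i)) : iIndepSet (fun i => x i ⁻¹' B i) P :=
  (iIndepSet_iff_meas_biInter fun i => hx i (hB i)).2 fun S =>
    hindep.measure_inter_preimage_eq_mul S fun i _ => hB i

theorem mgf_indicator_one_le [IsProbabilityMeasure P] {A : Set Ω} (hA : MeasurableSet A) (t : ℝ) :
    mgf (A.indicator 1) P t ≤ Real.exp ((Real.exp t - 1) * P.real A) := by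
  have hexp : (fun ω => Real.exp (t * A.indicator 1 ω)) =
      fun ω => 1 + A.indicator (fun _ => Real.exp t - 1) ω := by
    ext ω
    by_cases hω : ω ∈ A <;> simp [hω]
  rw [mgf, hexp, integral_add (integrable_const _) ((integrable_const _).indicator hA),
    integral_indicator_const _ hA]
  simpa [mul_comm, add_comm] using Real.add_one_le_exp ((Real.exp t - 1) * P.real A)

theorem sum_indicator_one_apply_eq_card {Ω ι : Type*} [Fintype ι] (A : ι → Set Ω) (ω : Ω)
    [DecidablePred fun i => ω ∈ A i] :
    (∑ i, (A i).indicator (1 : Ω → ℝ)) ω = #{i | ω ∈ A i} := by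
  classical
  simp [Finset.sum_apply, Set.indicator_apply]

open Classical in
theorem measureReal_card_le_le_exp [Fintype ι] {A : ι → Set Ω} (hA : ∀ i, MeasurableSet (A i))
    (hindep : iIndepSet A P) {t : ℝ} (ht : 0 ≤ t) (c : ℝ) :
    P.real {ω | (#{i | ω ∈ A i} : ℝ) ≤ c} ≤
      Real.exp (t * c - (1 - Real.exp (-t)) * ∑ i, P.real (A i)) := by
  have := hindep.isProbabilityMeasure
  have hmeas : ∀ i, Measurable ((A i).indicator (1 : Ω → ℝ)) := fun i =>
    measurable_one.indicator (hA i)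
  have hint : Integrable (fun ω => Real.exp (-t * (∑ i, (A i).indicator (1 : Ω → ℝ)) ω)) P := by
    refine Integrable.of_bound (C := 1) (by fun_prop) (.of_forall fun ω => ?_)
    rw [Real.norm_of_nonneg (Real.exp_pos _).le, Real.exp_le_one_iff,
      sum_indicator_one_apply_eq_card]
    exact mul_nonpos_of_nonpos_of_nonneg (neg_nonpos.2 ht) (Nat.cast_nonneg _)
  calc P.real {ω | (#{i | ω ∈ A i} : ℝ) ≤ c}
      = P.real {ω | (∑ i, (A i).indicator (1 : Ω → ℝ)) ω ≤ c} := by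
        simp only [sum_indicator_one_apply_eq_card]
    _ ≤ Real.exp (- -t * c) * mgf (∑ i, (A i).indicator 1) P (-t) :=
        measure_le_le_exp_mul_mgf c (neg_nonpos.2 ht) hint
    _ = Real.exp (t * c) * ∏ i, mgf ((A i).indicator 1) P (-t) := by
        rw [neg_neg]
        exact congrArg _ (hindep.iIndepFun_indicator.mgf_sum hmeas univ)
    _ ≤ Real.exp (t * c) * ∏ i, Real.exp ((Real.exp (-t) - 1) * P.real (A i)) := by
        gcongr with i
        · exact fun i _ => mgf_nonneg
        · exact mgf_indicator_one_le (hA i) _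
    _ = Real.exp (t * c - (1 - Real.exp (-t)) * ∑ i, P.real (A i)) := by
        rw [← Real.exp_sum, ← Real.exp_add, ← mul_sum]
        ring_nf

open Classical in
theorem measureReal_card_le_le_exp_neg_div_twelve [Fintype ι] {A : ι → Set Ω}
    (hA : ∀ i, MeasurableSet (A i)) (hindep : iIndepSet A P) {c : ℝ} (hc : 0 ≤ c)
    (hmean : 3 / 2 * c ≤ ∑ i, P.real (A i)) :
    P.real {ω | (#{i | ω ∈ A i} : ℝ) ≤ c} ≤ Real.exp (-c / 12) := by
  have hlog : Real.log (3 / 2) ≤ 5 / 12 := by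
    rw [Real.log_le_iff_le_exp (by norm_num)]
    exact le_trans (by norm_num) (Real.quadratic_le_exp_of_nonneg (x := 5 / 12) (by norm_num))
  refine (measureReal_card_le_le_exp hA hindep (Real.log_nonneg (by norm_num : (1 : ℝ) ≤ 3 / 2))
    c).trans (Real.exp_le_exp.2 ?_)
  rw [Real.exp_neg, Real.exp_log (by norm_num)]
  nlinarith

theorem measure_exists_mem_and_mem_le {F J : Type*} [MeasurableSpace F] [Countable J]
    [IsProbabilityMeasure P] {X : Ω → E} {Y : Ω → F} (hX : Measurable X) (hXY : IndepFun X Y P)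
    {C : J → Set E} {T : J → Set F} (hC : ∀ j, MeasurableSet (C j))
    (hT : ∀ j, MeasurableSet (T j)) {N q : ℝ≥0∞}
    (hN : ∀ a, ({j | a ∈ C j}.encard : ℝ≥0∞) ≤ N) (hq : ∀ j, P (Y ⁻¹' T j) ≤ q) :
    P {ω | ∃ j, X ω ∈ C j ∧ Y ω ∈ T j} ≤ N * q := by
  have hcount : ∀ ω, ∑' j, (X ⁻¹' C j).indicator 1 ω ≤ N := fun ω =>
    calc ∑' j, (X ⁻¹' C j).indicator (1 : Ω → ℝ≥0∞) ω
        = ∑' j, {j | X ω ∈ C j}.indicator 1 j := rfl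
      _ = {j | X ω ∈ C j}.encard := by
        rw [← _root_.tsum_subtype]
        exact ENNReal.tsum_set_one _
      _ ≤ N := hN (X ω)
  calc P {ω | ∃ j, X ω ∈ C j ∧ Y ω ∈ T j}
      ≤ ∑' j, P (X ⁻¹' C j ∩ Y ⁻¹' T j) :=
        (measure_mono fun ω hω => Set.mem_iUnion.2 hω).trans (measure_iUnion_le _)
    _ = ∑' j, P (X ⁻¹' C j) * P (Y ⁻¹' T j) :=
        tsum_congr fun j => hXY.measure_inter_preimage_eq_mul _ _ (hC j) (hT j)
    _ ≤ ∑' j, P (X ⁻¹' C j) * q := by gcongr with j; exact hq j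
    _ = (∫⁻ ω, ∑' j, (X ⁻¹' C j).indicator 1 ω ∂P) * q := by
        rw [lintegral_tsum fun j => (measurable_one.indicator (hX (hC j))).aemeasurable,
          ENNReal.tsum_mul_right]
        simp only [lintegral_indicator_one (hX (hC _))]
    _ ≤ (∫⁻ _, N ∂P) * q := by gcongr with ω; exact hcount ω
    _ = N * q := by simp

end Independence

section SubGaussian

open Finset

variable {Ω : Type*} [MeasurableSpace Ω] {P : Measure Ω}

theorem measureReal_sqrt_lt_abs_le [IsFiniteMeasure P] {X : Ω → ℝ} {c : ℝ≥0}
    (hX : HasSubgaussianMGF X c P) {L : ℝ} (hL : 0 ≤ L) :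
    P.real {ω | √(2 * c * L) < |X ω|} ≤ 2 * Real.exp (-L) := by
  rcases eq_or_ne c 0 with rfl | hc
  · have hnull : P {ω | √(2 * (0 : ℝ≥0) * L) < |X ω|} = 0 := by
      refine measure_mono_null (fun ω hω => ?_)
        (ae_iff.1 hX.ae_eq_zero_of_hasSubgaussianMGF_zero)
      simpa using hω
    rw [measureReal_def, hnull, ENNReal.toReal_zero]
    positivity
  have htail : ∀ {Z : Ω → ℝ}, HasSubgaussianMGF Z c P →
      P.real {ω | √(2 * c * L) ≤ Z ω} ≤ Real.exp (-L) := fun hZ => by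
    refine (hZ.measure_ge_le (Real.sqrt_nonneg _)).trans_eq ?_
    rw [Real.sq_sqrt (by positivity)]
    field_simp
  calc P.real {ω | √(2 * c * L) < |X ω|}
      ≤ P.real ({ω | √(2 * c * L) ≤ X ω} ∪ {ω | √(2 * c * L) ≤ (-X) ω}) :=
        measureReal_mono fun ω hω => le_abs.1 (Set.mem_ofPred.1 hω).le
    _ ≤ P.real {ω | √(2 * c * L) ≤ X ω} + P.real {ω | √(2 * c * L) ≤ (-X) ω} :=
        measureReal_union_le _ _
    _ ≤ 2 * Real.exp (-L) := by linarith [htail hX, htail hX.neg]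

theorem measureReal_card_mul_lt_abs_sum_le {ι : Type*} {ξ : ι → Ω → ℝ} (hindep : iIndepFun ξ P)
    {σ : ℝ≥0} {S : Finset ι} (hξ : ∀ i ∈ S, HasSubgaussianMGF (ξ i) (σ ^ 2) P) {L : ℝ}
    (hL : 0 ≤ L) {k : ℕ} (hk : 1 ≤ k) (hS : k ≤ #S) :
    P.real {ω | #S * (2 * σ * √(L / k)) < |∑ i ∈ S, ξ i ω|} ≤ 2 * Real.exp (-(2 * L)) := by
  have := hindep.isProbabilityMeasure
  have hkS : (k : ℝ) ≤ #S := by exact_mod_cast hS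
  have : (0 : ℝ) < k := by exact_mod_cast hk
  have hthreshold : √(2 * (∑ _i ∈ S, σ ^ 2 : ℝ≥0) * (2 * L)) ≤ #S * (2 * σ * √(L / k)) := by
    refine Real.sqrt_le_iff.2 ⟨by positivity, ?_⟩
    calc (2 * (∑ _i ∈ S, σ ^ 2 : ℝ≥0) * (2 * L) : ℝ) = #S * (4 * σ ^ 2 * (L / k)) * k := by
          simp only [sum_const, nsmul_eq_mul, NNReal.coe_mul, NNReal.coe_natCast, NNReal.coe_pow]
          field_simp
          ring
      _ ≤ #S * (4 * σ ^ 2 * (L / k)) * #S := by gcongr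
      _ = (#S * (2 * σ * √(L / k))) ^ 2 := by
          rw [mul_pow, mul_pow, Real.sq_sqrt (by positivity)]
          ring
  exact (measureReal_mono fun ω hω => hthreshold.trans_lt hω).trans
    (measureReal_sqrt_lt_abs_le (.sum_of_iIndepFun hindep hξ) (by positivity))

end SubGaussian

section Packing

open Finset Metric

variable {M : Type*} [PseudoMetricSpace M] [MeasurableSpace M] [OpensMeasurableSpace M]
  {μ : Measure M} {ε : ℝ≥0} {m : ℝ≥0∞}

theorem encard_mul_le_measure_univ_of_isSeparated (hμ : ∀ z, m ≤ μ (closedBall z (ε / 2)))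
    {C : Set M} (hC : IsSeparated ε C) : (C.encard : ℝ≥0∞) * m ≤ μ Set.univ := by
  have hdisj : Pairwise (Function.onFun Disjoint fun c : C => closedBall (c : M) (ε / 2)) := by
    intro a b hab
    have hfar : (ε : ℝ≥0∞) < edist (a : M) b := hC a.2 b.2 (Subtype.coe_ne_coe.2 hab)
    rw [edist_nndist, ENNReal.coe_lt_coe, ← NNReal.coe_lt_coe, coe_nndist] at hfar
    exact closedBall_disjoint_closedBall (by linarith)
  calc (C.encard : ℝ≥0∞) * m = ∑' _ : C, m := by rw [ENNReal.tsum_const]; rfl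
    _ ≤ ∑' c : C, μ (closedBall (c : M) (ε / 2)) := ENNReal.tsum_le_tsum fun c => hμ c
    _ ≤ μ (⋃ c : C, closedBall (c : M) (ε / 2)) :=
      tsum_meas_le_meas_iUnion_of_disjoint μ (fun _ => measurableSet_closedBall) hdisj
    _ ≤ μ Set.univ := measure_mono (Set.subset_univ _)

theorem exists_finset_card_mul_le_and_isCover [IsFiniteMeasure μ] (hm : m ≠ 0)
    (hμ : ∀ z, m ≤ μ (closedBall z (ε / 2))) :
    ∃ Z : Finset M, #Z * m ≤ μ Set.univ ∧ IsCover ε Set.univ (Z : Set M) := by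
  obtain ⟨C, hC⟩ : ∃ C : Set M, Maximal (fun N => N ⊆ Set.univ ∧ IsSeparated ε N) C :=
    zorn_subset _ fun c hc hchain => ⟨⋃₀ c, ⟨Set.subset_univ _,
      (Set.pairwise_sUnion hchain.directedOn).2 fun N hN => (hc hN).2⟩,
      fun _ => Set.subset_sUnion_of_mem⟩
  have hcard := encard_mul_le_measure_univ_of_isSeparated hμ hC.prop.2
  have hfin : C.Finite := by
    refine Set.encard_ne_top_iff.1 fun htop => measure_ne_top μ Set.univ (top_le_iff.1 ?_)
    rwa [htop, ENat.toENNReal_top, ENNReal.top_mul hm] at hcard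
  refine ⟨hfin.toFinset, ?_, by simpa using IsCover.of_maximal_isSeparated hC⟩
  rwa [hfin.encard_eq_coe_toFinset_card, ENat.toENNReal_coe] at hcard

end Packing

section LowerRegular

open Finset Metric

variable {M : Type*} [PseudoMetricSpace M] [MeasurableSpace M] {μ : Measure M} {a d r₀ R : ℝ}

/-- The lower half of Ahlfors `d`-regularity, with constant `a` and up to scale `r₀`. It bounds the
size of nets from above and the number of sample points in a ball from below. -/
def LowerRegular (μ : Measure M) (a d r₀ : ℝ) : Prop :=
  ∀ (z : M) (r : ℝ), 0 < r → r < r₀ → a * r ^ d ≤ μ.real (closedBall z r)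

theorem three_quarters_le_rpow (hd : 1 ≤ d) : 3 / 4 ≤ (1 - 1 / (4 * d)) ^ d := by
  have hle : 1 / (4 * d) ≤ 1 / 4 := one_div_le_one_div_of_le (by norm_num) (by linarith)
  have hbernoulli := one_add_mul_self_le_rpow_one_add (s := -(1 / (4 * d))) (by linarith) hd
  have hd₀ : d ≠ 0 := by positivity
  calc (3 / 4 : ℝ) = 1 + d * -(1 / (4 * d)) := by field_simp; norm_num
    _ ≤ (1 - 1 / (4 * d)) ^ d := hbernoulli

theorem LowerRegular.three_quarters_mul_le (hμ : LowerRegular μ a d r₀) (hd : 1 ≤ d) (ha : 0 ≤ a)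
    (hR : 0 < R) (hRr₀ : R ≤ r₀) (z : M) :
    3 / 4 * (a * R ^ d) ≤ μ.real (closedBall z ((1 - 1 / (4 * d)) * R)) := by
  have hpos : 0 < 1 / (4 * d) := by positivity
  have hle : 1 / (4 * d) ≤ 1 / 4 := one_div_le_one_div_of_le (by norm_num) (by linarith)
  calc 3 / 4 * (a * R ^ d) ≤ (1 - 1 / (4 * d)) ^ d * (a * R ^ d) := by
        gcongr; exact three_quarters_le_rpow hd
    _ = a * ((1 - 1 / (4 * d)) * R) ^ d := by
        rw [Real.mul_rpow (by linarith) hR.le]; ring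
    _ ≤ μ.real (closedBall z ((1 - 1 / (4 * d)) * R)) :=
        hμ z _ (mul_pos (by linarith) hR) (by nlinarith)

theorem LowerRegular.exists_finset_cover [OpensMeasurableSpace M] [IsFiniteMeasure μ]
    (hμ : LowerRegular μ a d r₀) (ha : 0 < a) {r : ℝ} (hr : 0 < r) (hr₀ : r < r₀) :
    ∃ Z : Finset M, #Z * (a * r ^ d) ≤ μ.real Set.univ ∧ ∀ z, ∃ c ∈ Z, dist z c ≤ 2 * r := by
  lift r to ℝ≥0 using hr.le
  have hmass : 0 < a * (r : ℝ) ^ d := by positivity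
  obtain ⟨Z, hcard, hcover⟩ := exists_finset_card_mul_le_and_isCover (μ := μ) (ε := 2 * r)
    (m := ENNReal.ofReal (a * r ^ d)) (by simpa using hmass) fun z => by
      have hrad : ((2 * r : ℝ≥0) : ℝ) / 2 = r := by simp
      rw [hrad, ENNReal.ofReal_le_iff_le_toReal (measure_ne_top _ _)]
      exact hμ z r hr hr₀
  refine ⟨Z, ?_, fun z => ?_⟩
  · simpa [ENNReal.toReal_ofReal hmass.le, measureReal_def] using
      ENNReal.toReal_mono (measure_ne_top _ _) hcard
  · have hz := isCover_iff_subset_iUnion_closedBall.1 hcover (Set.mem_univ z)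
    simpa using hz

end LowerRegular

section Coverage

open Finset Metric

variable {Ω ι M : Type*} [MeasurableSpace Ω] {P : Measure Ω} [Fintype ι] [PseudoMetricSpace M]
  [MeasurableSpace M] [OpensMeasurableSpace M] {x : ι → Ω → M} {a d r₀ R : ℝ} {k : ℕ}

theorem measure_card_ballTrace_lt_le (hx : ∀ i, Measurable (x i)) (hindep : iIndepFun x P)
    (hmass : ∀ i, LowerRegular (P.map (x i)) a d r₀) (hd : 1 ≤ d) (ha : 0 ≤ a) (hR : 0 < R)
    (hRr₀ : R ≤ r₀) (hk : 2 * k ≤ Fintype.card ι * (a * R ^ d)) (c : M) :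
    P {ω | #(ballTrace (fun i => x i ω) c ((1 - 1 / (4 * d)) * R)) < k} ≤
      ENNReal.ofReal (Real.exp (-k / 12)) := by
  classical
  have := hindep.isProbabilityMeasure
  set B : Set M := closedBall c ((1 - 1 / (4 * d)) * R)
  have hB : MeasurableSet B := measurableSet_closedBall
  have hmean : 3 / 2 * (k : ℝ) ≤ ∑ i, P.real (x i ⁻¹' B) :=
    calc 3 / 2 * (k : ℝ) ≤ ∑ _i : ι, 3 / 4 * (a * R ^ d) := by
          rw [sum_const, card_univ, nsmul_eq_mul]; linarith
      _ ≤ ∑ i, P.real (x i ⁻¹' B) := sum_le_sum fun i _ => by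
          rw [← map_measureReal_apply (hx i) hB]
          exact (hmass i).three_quarters_mul_le hd ha hR hRr₀ c
  rw [← ofReal_measureReal]
  refine ENNReal.ofReal_le_ofReal ((measureReal_mono fun ω hω => ?_).trans
    (measureReal_card_le_le_exp_neg_div_twelve (fun i => hx i hB)
      (iIndepSet_preimage hx hindep fun _ => hB) k.cast_nonneg hmean))
  have hle : #(ballTrace (fun i => x i ω) c ((1 - 1 / (4 * d)) * R)) ≤ k :=
    (Set.mem_ofPred.1 hω).le
  simpa [ballTrace, B] using hle

-- A ball of radius `R` contains the ball of radius `(1 - 1 / (4 * d)) * R` around the nearest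
-- point of an `R / (4 * d)`-net, so that a union bound over the net suffices.
theorem measure_exists_card_ballTrace_lt_le [Nonempty ι] (hx : ∀ i, Measurable (x i))
    (hindep : iIndepFun x P) (hmass : ∀ i, LowerRegular (P.map (x i)) a d r₀) (hd : 1 ≤ d)
    (ha : 0 < a) (hR : 0 < R) (hRr₀ : R ≤ r₀) (hk : 2 * k ≤ Fintype.card ι * (a * R ^ d)) :
    P {ω | ∃ z, #(ballTrace (fun i => x i ω) z R) < k} ≤
      ENNReal.ofReal ((8 * d) ^ d / (a * R ^ d) * Real.exp (-k / 12)) := by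
  have := hindep.isProbabilityMeasure
  obtain ⟨i₀⟩ := ‹Nonempty ι›
  have := Measure.isProbabilityMeasure_map (μ := P) (hx i₀).aemeasurable
  obtain ⟨Z, hcard, hcover⟩ := (hmass i₀).exists_finset_cover ha (r := R / (8 * d))
    (by positivity) ((div_lt_self hR (by linarith)).trans_le hRr₀)
  have hZ : (#Z : ℝ) ≤ (8 * d) ^ d / (a * R ^ d) := by
    rw [Real.div_rpow hR.le (by positivity), probReal_univ] at hcard
    rw [le_div_iff₀ (by positivity)]
    have h8 : 0 < (8 * d) ^ d := by positivity
    field_simp at hcard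
    linarith
  calc P {ω | ∃ z, #(ballTrace (fun i => x i ω) z R) < k}
      ≤ P (⋃ c ∈ Z, {ω | #(ballTrace (fun i => x i ω) c ((1 - 1 / (4 * d)) * R)) < k}) := by
        refine measure_mono ?_
        rintro ω ⟨z, hz⟩
        obtain ⟨c, hc, hzc⟩ := hcover z
        have hsub : ballTrace (fun i => x i ω) c ((1 - 1 / (4 * d)) * R) ⊆
            ballTrace (fun i => x i ω) z R := fun i hi => by
          rw [mem_ballTrace] at hi ⊢
          calc dist (x i ω) z ≤ dist (x i ω) c + dist z c := dist_triangle_right _ _ _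
            _ ≤ (1 - 1 / (4 * d)) * R + 2 * (R / (8 * d)) := add_le_add hi hzc
            _ = R := by field_simp; ring
        exact Set.mem_biUnion hc ((card_le_card hsub).trans_lt hz)
    _ ≤ ∑ c ∈ Z, P {ω | #(ballTrace (fun i => x i ω) c ((1 - 1 / (4 * d)) * R)) < k} :=
        measure_biUnion_finset_le _ _
    _ ≤ ∑ _c ∈ Z, ENNReal.ofReal (Real.exp (-k / 12)) := sum_le_sum fun c _ =>
        measure_card_ballTrace_lt_le hx hindep hmass hd ha.le hR hRr₀ hk c
    _ = ENNReal.ofReal (#Z * Real.exp (-k / 12)) := by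
        rw [sum_const, nsmul_eq_mul, ENNReal.ofReal_mul (by positivity), ENNReal.ofReal_natCast]
    _ ≤ ENNReal.ofReal ((8 * d) ^ d / (a * R ^ d) * Real.exp (-k / 12)) := by gcongr

end Coverage

section Noise

open Finset Metric

variable {Ω M : Type*} [MeasurableSpace Ω] {P : Measure Ω} [PseudoMetricSpace M]
  [SecondCountableTopology M] [MeasurableSpace M] [OpensMeasurableSpace M]

theorem measure_exists_mem_ballTraces_lt_abs_sum_le {v n k : ℕ} (hM : BallVCDimLE M v)
    (hv : 2 ≤ v) (hn : 2 ≤ n) {x : Fin n → Ω → M} (hx : ∀ i, Measurable (x i))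
    {ξ : Fin n → Ω → ℝ} (hindep : iIndepFun ξ P)
    (hxξ : IndepFun (fun ω i => x i ω) (fun ω i => ξ i ω) P) {σ : ℝ≥0}
    (hξ : ∀ i, HasSubgaussianMGF (ξ i) (σ ^ 2) P) {L : ℝ} (hL : 0 ≤ L) (hk : 1 ≤ k) :
    P {ω | ∃ S, S ∈ ballTraces (fun i => x i ω) ∧ k ≤ #S ∧
        #S * (2 * σ * √(L / k)) < |∑ i ∈ S, ξ i ω|} ≤
      n ^ v * ENNReal.ofReal (2 * Real.exp (-(2 * L))) := by
  have := hindep.isProbabilityMeasure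
  refine measure_exists_mem_and_mem_le (measurable_pi_lambda _ hx) hxξ
    (C := fun S => {s | S ∈ ballTraces s})
    (T := fun S => {e | k ≤ #S ∧ #S * (2 * σ * √(L / k)) < |∑ i ∈ S, e i|})
    (fun S => (isOpen_setOf_mem_ballTraces S).measurableSet) (fun S => ?_) (fun s => ?_)
    fun S => ?_
  · have habs : Measurable fun e : Fin n → ℝ => |∑ i ∈ S, e i| := by fun_prop
    exact (MeasurableSet.const _).inter (measurableSet_lt measurable_const habs)
  · have hcount : {S | S ∈ ballTraces s}.encard = #(ballTraces s) :=
      Set.encard_coe_eq_coe_finsetCard (ballTraces s)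
    calc (({S | S ∈ ballTraces s}.encard : ℕ∞) : ℝ≥0∞) = #(ballTraces s) := by
          rw [hcount, ENat.toENNReal_coe]
      _ ≤ n ^ v := by exact_mod_cast hM.card_ballTraces_le hn hv s
  · by_cases hS : k ≤ #S
    · rw [← ofReal_measureReal]
      refine ENNReal.ofReal_le_ofReal ((measureReal_mono fun ω hω => ?_).trans
        (measureReal_card_mul_lt_abs_sum_le hindep (fun i _ => hξ i) hL hk hS))
      exact hω.2
    · simp [hS]

end Noise

section Numerics

variable {δ d : ℝ} {v n k : ℕ}

theorem one_le_log_four_div (hδ₀ : 0 < δ) (hδ₁ : δ < 1) : 1 ≤ Real.log (4 / δ) := by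
  rw [Real.le_log_iff_exp_le (by positivity)]
  exact Real.exp_one_lt_three.le.trans (by rw [le_div_iff₀ hδ₀]; linarith)

theorem one_half_le_log_natCast (hn : 2 ≤ n) : 1 / 2 ≤ Real.log n :=
  calc (1 / 2 : ℝ) ≤ Real.log 2 := by linarith [Real.log_two_gt_d9]
    _ ≤ Real.log n := Real.log_le_log two_pos (by exact_mod_cast hn)

theorem cover_probability_le (hδ₀ : 0 < δ) (hδ₁ : δ < 1) (hd : 1 ≤ d) (hn : 2 ≤ n) (hk : 1 ≤ k)
    (hk_lower : 2 ^ 8 * d * Real.log (4 / δ) ^ 2 * Real.log n ≤ k) (hkn : (k : ℝ) ≤ n) :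
    (8 * d) ^ d * (n / (2 * k)) * Real.exp (-k / 12) ≤ δ / 2 := by
  have hL := one_le_log_four_div hδ₀ hδ₁
  have hl := one_half_le_log_natCast hn
  set L := Real.log (4 / δ) with hL_def
  set l := Real.log n with hl_def
  have hk₁ : (1 : ℝ) ≤ k := by exact_mod_cast hk
  have hn₀ : (0 : ℝ) < n := by linarith
  have hdl : d / 2 ≤ d * l := by nlinarith
  have hdlL : d * l ≤ d * l * L ^ 2 := le_mul_of_one_le_right (by nlinarith) (by nlinarith)
  have hLdlL : L ≤ 2 * (d * l * L ^ 2) := by nlinarith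
  have hexponent : (d + 1) * l + -k / 12 ≤ -L := by nlinarith
  have hratio : (n : ℝ) / (2 * k) ≤ n := div_le_self hn₀.le (by linarith)
  calc (8 * d) ^ d * (n / (2 * k)) * Real.exp (-k / 12)
      ≤ (n : ℝ) ^ d * n * Real.exp (-k / 12) := by gcongr; linarith
    _ = Real.exp ((d + 1) * l + -k / 12) := by
        rw [Real.exp_add, mul_comm _ l, hl_def, ← Real.rpow_def_of_pos hn₀, Real.rpow_add hn₀,
          Real.rpow_one]
    _ ≤ Real.exp (-L) := Real.exp_le_exp.2 hexponent
    _ = δ / 4 := by rw [Real.exp_neg, hL_def, Real.exp_log (by positivity), inv_div]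
    _ ≤ δ / 2 := by linarith

theorem noise_probability_le (hδ₀ : 0 < δ) (hδ₁ : δ < 1) (hn : 0 < n) :
    (n : ℝ) ^ v * (2 * Real.exp (-(2 * (v / 2 * Real.log n + Real.log (2 / δ))))) ≤ δ / 2 := by
  have hn₀ : (0 : ℝ) < n := by exact_mod_cast hn
  have hexp : Real.exp (-(2 * (v / 2 * Real.log n + Real.log (2 / δ)))) =
      ((n : ℝ) ^ v)⁻¹ * (δ / 2) ^ 2 := by
    rw [← Real.exp_log (pow_pos hn₀ v), Real.log_pow, ← inv_div 2 δ,
      ← Real.exp_log (by positivity : 0 < 2 / δ), ← Real.exp_neg, ← Real.exp_neg,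
      ← Real.exp_nat_mul, ← Real.exp_add, Real.log_exp]
    congr 1
    push_cast
    ring
  calc (n : ℝ) ^ v * (2 * Real.exp (-(2 * (v / 2 * Real.log n + Real.log (2 / δ)))))
      = δ ^ 2 / 2 := by rw [hexp]; field_simp
    _ ≤ δ / 2 := by nlinarith

end Numerics

section Radius

variable {a d r₀ : ℝ} {n k : ℕ}

theorem natCast_mul_mul_rpow_eq (ha : 0 < a) (hd : d ≠ 0) (hn : 0 < n) :
    n * (a * ((2 * k / (a * n) : ℝ) ^ (1 / d)) ^ d) = 2 * k := by
  rw [one_div, Real.rpow_inv_rpow (by positivity) hd]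
  field_simp

theorem rpow_one_div_le_of_natCast_le (ha : 0 < a) (hd : 0 < d) (hr₀ : 0 ≤ r₀) (hn : 0 < n)
    (hk : k ≤ 1 / 2 * a * r₀ ^ d * n) : (2 * k / (a * n) : ℝ) ^ (1 / d) ≤ r₀ := by
  rw [one_div, Real.rpow_inv_le_iff_of_pos (by positivity) hr₀ hd, div_le_iff₀ (by positivity)]
  linarith

theorem LowerRegular.three_halves_mul_le_natCast {M : Type*} [PseudoMetricSpace M]
    [MeasurableSpace M] [Nonempty M] {μ : Measure M} [IsProbabilityMeasure μ]
    (hμ : LowerRegular μ a d r₀) (hd : 1 ≤ d) (ha : 0 ≤ a) {R : ℝ} (hR : 0 < R) (hRr₀ : R ≤ r₀)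
    (hk : 2 * k ≤ n * (a * R ^ d)) : 3 / 2 * (k : ℝ) ≤ n := by
  obtain ⟨z⟩ := ‹Nonempty M›
  have hle : 3 / 4 * (a * R ^ d) ≤ 1 :=
    (hμ.three_quarters_mul_le hd ha hR hRr₀ z).trans measureReal_le_one
  nlinarith [(n.cast_nonneg : (0 : ℝ) ≤ n)]

end Radius

section Deviation

open Finset Metric

variable {Ω : Type*} [MeasurableSpace Ω] {P : Measure Ω}

theorem exists_measurableSet_forall_of_measure_not_le [IsProbabilityMeasure P] {p : Ω → Prop}
    {δ : ℝ} (hδ : 0 ≤ δ) (hp : P {ω | ¬ p ω} ≤ ENNReal.ofReal δ) :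
    ∃ A, MeasurableSet A ∧ ENNReal.ofReal (1 - δ) ≤ P A ∧ ∀ ω ∈ A, p ω := by
  refine ⟨(toMeasurable P {ω | ¬ p ω})ᶜ, (measurableSet_toMeasurable _ _).compl, ?_, fun ω hω => ?_⟩
  · rw [prob_compl_eq_one_sub (measurableSet_toMeasurable _ _), measure_toMeasurable,
      ENNReal.ofReal_sub _ hδ, ENNReal.ofReal_one]
    exact tsub_le_tsub_left hp 1
  · exact not_not.1 fun h => hω (subset_toMeasurable _ _ h)

theorem measure_not_forall_kNNRegression_le_add {M : Type*} [PseudoMetricSpace M]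
    {n k : ℕ} (hk : 1 ≤ k) {f : M → ℝ} {x : Fin n → Ω → M} {ξ y : Fin n → Ω → ℝ}
    (hinj : ∀ᵐ ω ∂P, Function.Injective fun i => x i ω)
    (hy : ∀ i ω, y i ω = f (x i ω) + ξ i ω) (R : ℝ) {t : ℝ} (ht : 0 ≤ t) :
    P {ω | ¬ ∀ z, ENNReal.ofReal |f z - kNNRegression (fun i => x i ω) (fun i => y i ω) k z| ≤
        modulus f z R + ENNReal.ofReal t} ≤
      P {ω | ∃ z, #(ballTrace (fun i => x i ω) z R) < k} +
        P {ω | ∃ S, S ∈ ballTraces (fun i => x i ω) ∧ k ≤ #S ∧ #S * t < |∑ i ∈ S, ξ i ω|} := by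
  refine (measure_mono_ae ?_).trans (measure_union_le _ _)
  filter_upwards [hinj] with ω hω hfail
  by_contra! hgood
  obtain ⟨hcover, hnoise⟩ := not_or.1 hgood
  refine hfail fun z => ofReal_abs_sub_kNNRegression_le hω hk (fun i => hy i ω) ht ?_ ?_
  · exact not_lt.1 fun h => hcover ⟨z, h⟩
  · exact fun S hS hkS => not_lt.1 fun h => hnoise ⟨S, hS, hkS, h⟩

theorem measure_not_forall_kNNRegression_le {M : Type*} [MetricSpace M] [SecondCountableTopology M]
    [MeasurableSpace M] [OpensMeasurableSpace M] {v : ℕ} (hv : 2 ≤ v) (hM : BallVCDimLE M v)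
    (f : M → ℝ) {a d r₀ R : ℝ} (ha : 0 < a) (hd : 1 ≤ d) (hR : 0 < R) (hRr₀ : R ≤ r₀) {n k : ℕ}
    (hn : 2 ≤ n) (hk : 1 ≤ k) (hkn : (k : ℝ) ≤ n) (hnR : n * (a * R ^ d) = 2 * k)
    {x : Fin n → Ω → M} (hx : ∀ i, Measurable (x i)) (hx_indep : iIndepFun x P)
    (hatom : ∀ i, NullSingletonClass (P.map (x i)))
    (hmass : ∀ i, LowerRegular (P.map (x i)) a d r₀) {ξ : Fin n → Ω → ℝ} (hξ_indep : iIndepFun ξ P)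
    {σ : ℝ≥0} (hξ : ∀ i, HasSubgaussianMGF (ξ i) (σ ^ 2) P)
    (hxξ_indep : IndepFun (fun ω i => x i ω) (fun ω i => ξ i ω) P)
    {y : Fin n → Ω → ℝ} (hy : ∀ i ω, y i ω = f (x i ω) + ξ i ω)
    {δ : ℝ} (hδ₀ : 0 < δ) (hδ₁ : δ < 1)
    (hk_lower : 2 ^ 8 * d * Real.log (4 / δ) ^ 2 * Real.log n ≤ k) :
    P {ω | ¬ ∀ z, ENNReal.ofReal |f z - kNNRegression (fun i => x i ω) (fun i => y i ω) k z| ≤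
        modulus f z R +
          ENNReal.ofReal (2 * σ * √((v / 2 * Real.log n + Real.log (2 / δ)) / k))} ≤
      ENNReal.ofReal δ := by
  have : Nonempty (Fin n) := ⟨⟨0, by omega⟩⟩
  have hratio : (8 * d) ^ d / (a * R ^ d) = (8 * d) ^ d * (n / (2 * k)) := by
    rw [← hnR]
    field_simp
  have hcover : P {ω | ∃ z, #(ballTrace (fun i => x i ω) z R) < k} ≤ ENNReal.ofReal (δ / 2) := by
    refine (measure_exists_card_ballTrace_lt_le hx hx_indep hmass hd ha hR hRr₀
      (by simpa using hnR.ge)).trans (ENNReal.ofReal_le_ofReal ?_)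
    rw [hratio]
    exact cover_probability_le hδ₀ hδ₁ hd hn hk hk_lower hkn
  have hL : 0 ≤ v / 2 * Real.log n + Real.log (2 / δ) :=
    add_nonneg (by positivity) (Real.log_nonneg (by rw [le_div_iff₀ hδ₀]; linarith))
  have hnoise := measure_exists_mem_ballTraces_lt_abs_sum_le hM hv hn hx hξ_indep hxξ_indep hξ hL hk
  rw [← ENNReal.ofReal_natCast, ← ENNReal.ofReal_pow n.cast_nonneg,
    ← ENNReal.ofReal_mul (by positivity)] at hnoise
  calc _ ≤ _ := measure_not_forall_kNNRegression_le_add hk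
        (ae_injective_of_iIndepFun hx hx_indep hatom) hy R (by positivity)
    _ ≤ ENNReal.ofReal (δ / 2) + ENNReal.ofReal (δ / 2) :=
        add_le_add hcover (hnoise.trans
          (ENNReal.ofReal_le_ofReal (noise_probability_le hδ₀ hδ₁ (by omega))))
    _ = ENNReal.ofReal δ := by
        rw [← ENNReal.ofReal_add (by positivity) (by positivity), add_halves]

end Deviation

section Density

open Metric

variable {D : ℕ} {p : EuclideanSpace ℝ (Fin D) → ℝ} {𝒳 : Set (EuclideanSpace ℝ (Fin D))}

theorem unitBallVolume_pos (D : ℕ) : 0 < unitBallVolume D :=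
  ENNReal.toReal_pos (measure_closedBall_pos _ _ one_pos).ne' measure_closedBall_lt_top.ne

theorem ofReal_pow_mul_unitBallVolume (z : EuclideanSpace ℝ (Fin D)) {r : ℝ} (hr : 0 ≤ r) :
    ENNReal.ofReal (r ^ D * unitBallVolume D) = volume (closedBall z r) := by
  rw [Measure.addHaar_closedBall' _ _ hr, finrank_euclideanSpace_fin,
    ENNReal.ofReal_mul (by positivity), unitBallVolume,
    ENNReal.ofReal_toReal measure_closedBall_lt_top.ne]

theorem IsDensityWithSupport.measurableSet (hp : IsDensityWithSupport p 𝒳) : MeasurableSet 𝒳 :=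
  hp.support_eq ▸ measurableSet_support hp.measurable

theorem IsDensityWithSupport.densityInf_le (hp : IsDensityWithSupport p 𝒳) {z} (hz : z ∈ 𝒳) :
    densityInf p 𝒳 ≤ p z :=
  csInf_le ⟨0, Set.forall_mem_image.2 fun _ _ => hp.nonneg _⟩ ⟨z, hz, rfl⟩

theorem IsDensityWithSupport.densityInf_nonneg (hp : IsDensityWithSupport p 𝒳) :
    0 ≤ densityInf p 𝒳 :=
  Real.sInf_nonneg (Set.forall_mem_image.2 fun _ _ => hp.nonneg _)

theorem IsDensityWithSupport.ofReal_densityInf_mul_volume_le (hp : IsDensityWithSupport p 𝒳)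
    {B : Set (EuclideanSpace ℝ (Fin D))} (hB : MeasurableSet B) :
    ENNReal.ofReal (densityInf p 𝒳) * volume (𝒳 ∩ B) ≤ densityMeasure p B :=
  calc ENNReal.ofReal (densityInf p 𝒳) * volume (𝒳 ∩ B)
      = ∫⁻ _ in 𝒳 ∩ B, ENNReal.ofReal (densityInf p 𝒳) := (setLIntegral_const _ _).symm
    _ ≤ ∫⁻ y in 𝒳 ∩ B, ENNReal.ofReal (p y) :=
        setLIntegral_mono' (hp.measurableSet.inter hB) fun _ hy =>
          ENNReal.ofReal_le_ofReal (hp.densityInf_le hy.1)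
    _ ≤ ∫⁻ y in B, ENNReal.ofReal (p y) := lintegral_mono_set Set.inter_subset_right
    _ = densityMeasure p B := (withDensity_apply _ hB).symm

theorem IsDensityWithSupport.ofReal_le_densityMeasure_closedBall (hp : IsDensityWithSupport p 𝒳)
    {γ r₀ : ℝ} (hreg : SupportRegular 𝒳 γ r₀) {z : EuclideanSpace ℝ (Fin D)} (hz : z ∈ 𝒳)
    {r : ℝ} (hr : 0 < r) (hr₀ : r < r₀) :
    ENNReal.ofReal (γ * densityInf p 𝒳 * unitBallVolume D * r ^ D) ≤
      densityMeasure p (closedBall z r) :=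
  calc ENNReal.ofReal (γ * densityInf p 𝒳 * unitBallVolume D * r ^ D)
      = ENNReal.ofReal (densityInf p 𝒳) * (ENNReal.ofReal γ * volume (closedBall z r)) := by
        rw [← ofReal_pow_mul_unitBallVolume z hr.le, ← ENNReal.ofReal_mul hreg.1.le,
          ← ENNReal.ofReal_mul hp.densityInf_nonneg]
        ring_nf
    _ ≤ ENNReal.ofReal (densityInf p 𝒳) * volume (𝒳 ∩ closedBall z r) := by
        gcongr
        exact hreg.2.2 z hz r hr hr₀
    _ ≤ densityMeasure p (closedBall z r) :=
        hp.ofReal_densityInf_mul_volume_le measurableSet_closedBall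

theorem IsDensityWithSupport.lowerRegular (hp : IsDensityWithSupport p 𝒳) {γ r₀ : ℝ}
    (hreg : SupportRegular 𝒳 γ r₀) {μ : Measure 𝒳} [IsFiniteMeasure μ]
    (hμ : μ.map Subtype.val = densityMeasure p) :
    LowerRegular μ (γ * densityInf p 𝒳 * unitBallVolume D) D r₀ := by
  intro z r hr hr₀
  rw [Real.rpow_natCast, measureReal_def, ← ENNReal.ofReal_le_iff_le_toReal (measure_ne_top _ _)]
  simpa [← hμ, Measure.map_apply measurable_subtype_coe measurableSet_closedBall] using
    hp.ofReal_le_densityMeasure_closedBall hreg z.2 hr hr₀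

theorem nullSingletonClass_of_map_coe_eq_densityMeasure (hD : 1 ≤ D) {μ : Measure 𝒳}
    (hμ : μ.map Subtype.val = densityMeasure p) : NullSingletonClass μ where
  measure_singleton z := by
    have : Nonempty (Fin D) := ⟨⟨0, hD⟩⟩
    have hnull : densityMeasure p {(z : EuclideanSpace ℝ (Fin D))} = 0 :=
      withDensity_absolutelyContinuous _ _ (measure_singleton _)
    rw [← hμ, Measure.map_apply measurable_subtype_coe (.singleton _)] at hnull
    exact measure_mono_null (by rintro _ rfl; rfl) hnull

end Density

end KNN

theorem theorem1_general {Ω M : Type*} [MeasurableSpace Ω] {P : Measure Ω} [MetricSpace M]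
    [SecondCountableTopology M] [MeasurableSpace M] [OpensMeasurableSpace M] {v : ℕ} (hv : 2 ≤ v)
    (hM : KNN.BallVCDimLE M v) (f : M → ℝ) {a d r₀ : ℝ} (ha : 0 < a) (hd : 1 ≤ d) (hr₀ : 0 < r₀)
    {n : ℕ} {x : Fin n → Ω → M} (hx : ∀ i, Measurable (x i)) (hx_indep : iIndepFun x P)
    (hatom : ∀ i, NullSingletonClass (P.map (x i)))
    (hmass : ∀ i, KNN.LowerRegular (P.map (x i)) a d r₀)
    {ξ : Fin n → Ω → ℝ} (hξ_indep : iIndepFun ξ P) {σ : ℝ≥0}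
    (hξ : ∀ i, HasSubgaussianMGF (ξ i) (σ ^ 2) P)
    (hxξ_indep : IndepFun (fun ω i => x i ω) (fun ω i => ξ i ω) P)
    {y : Fin n → Ω → ℝ} (hy : ∀ i ω, y i ω = f (x i ω) + ξ i ω)
    {δ : ℝ} (hδ₀ : 0 < δ) (hδ₁ : δ < 1) {k : ℕ} (hk : 1 ≤ k)
    (hk_lower : 2 ^ 8 * d * Real.log (4 / δ) ^ 2 * Real.log n ≤ k)
    (hk_upper : k ≤ 1 / 2 * a * r₀ ^ d * n) :
    ∃ A : Set Ω, MeasurableSet A ∧ ENNReal.ofReal (1 - δ) ≤ P A ∧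
      ∀ ω ∈ A, ∀ z,
        ENNReal.ofReal |f z - KNN.kNNRegression (fun i => x i ω) (fun i => y i ω) k z| ≤
          KNN.modulus f z ((2 * k / (a * n)) ^ (1 / d)) +
            ENNReal.ofReal (2 * σ * √((v / 2 * Real.log n + Real.log (2 / δ)) / k)) := by
  have := hx_indep.isProbabilityMeasure
  have hn : 0 < n := Nat.pos_of_ne_zero fun hn => by simp [hn] at hk_upper; omega
  have hR : 0 < (2 * k / (a * n) : ℝ) ^ (1 / d) := by positivity
  have hRr₀ : (2 * k / (a * n) : ℝ) ^ (1 / d) ≤ r₀ :=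
    KNN.rpow_one_div_le_of_natCast_le ha (by positivity) hr₀.le hn hk_upper
  have hnR := KNN.natCast_mul_mul_rpow_eq (k := k) ha (by positivity : d ≠ 0) hn
  have hkn : 3 / 2 * (k : ℝ) ≤ n := by
    have := Measure.isProbabilityMeasure_map (μ := P) (hx ⟨0, hn⟩).aemeasurable
    have : Nonempty M := nonempty_of_isProbabilityMeasure (P.map (x ⟨0, hn⟩))
    exact (hmass ⟨0, hn⟩).three_halves_mul_le_natCast hd ha.le hR hRr₀ hnR.ge
  have hk₁ : (1 : ℝ) ≤ k := by exact_mod_cast hk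
  have hn₂ : 2 ≤ n := Nat.succ_le_of_lt (Nat.one_lt_cast (α := ℝ).1 (by linarith))
  exact KNN.exists_measurableSet_forall_of_measure_not_le hδ₀.le <|
    KNN.measure_not_forall_kNNRegression_le hv hM f ha hd hR hRr₀ hn₂ hk (by linarith) hnR hx
      hx_indep hatom hmass hξ_indep hξ hxξ_indep hy hδ₀ hδ₁ hk_lower

theorem theorem1 {Ω : Type*} [MeasurableSpace Ω] (P : Measure Ω) [IsProbabilityMeasure P]
    {D : ℕ} (hD : 1 ≤ D)
    (𝒳 : Set (EuclideanSpace ℝ (Fin D))) (h𝒳 : IsCompact 𝒳)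
    -- the regression function: arbitrary, not assumed continuous, bounded or measurable
    (f : 𝒳 → ℝ)
    -- support regularity
    (γ r₀ : ℝ) (hreg : KNN.SupportRegular 𝒳 γ r₀)
    -- the design density, bounded from below on its support
    (p : EuclideanSpace ℝ (Fin D) → ℝ) (hp : KNN.IsDensityWithSupport p 𝒳)
    (hp₀ : 0 < KNN.densityInf p 𝒳)
    -- the law of the noise: mean zero and sub-Gaussian
    (ν : Measure ℝ) [IsProbabilityMeasure ν] (σ : ℝ≥0) (hν : KNN.SubGaussianNoise ν σ)
    -- the design points are i.i.d. with density `p`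
    (n : ℕ) (x : Fin n → Ω → 𝒳) (hx_meas : ∀ i, Measurable (x i)) (hx_indep : iIndepFun x P)
    (hx_law : ∀ i, P.map (fun ω => (x i ω : EuclideanSpace ℝ (Fin D))) = KNN.densityMeasure p)
    -- the noise variables are i.i.d. with law `ν`, and independent of the design points
    (ξ : Fin n → Ω → ℝ) (hξ_meas : ∀ i, Measurable (ξ i)) (hξ_indep : iIndepFun ξ P)
    (hξ_law : ∀ i, P.map (ξ i) = ν)
    (hxξ_indep : IndepFun (fun ω i => x i ω) (fun ω i => ξ i ω) P)
    -- the observations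
    (y : Fin n → Ω → ℝ) (hy : ∀ i ω, y i ω = f (x i ω) + ξ i ω)
    (δ : ℝ) (hδ₀ : 0 < δ) (hδ₁ : δ < 1)
    (k : ℕ) (hk : 1 ≤ k)
    (hk_lower : 2 ^ 8 * (D : ℝ) * Real.log (4 / δ) ^ 2 * Real.log n ≤ k)
    (hk_upper : (k : ℝ) ≤
      1 / 2 * γ * KNN.densityInf p 𝒳 * KNN.unitBallVolume D * r₀ ^ D * n) :
    ∃ A : Set Ω, MeasurableSet A ∧ ENNReal.ofReal (1 - δ) ≤ P A ∧
      ∀ ω ∈ A, ∀ z : 𝒳,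
        ENNReal.ofReal |f z - KNN.kNNRegression (fun i => x i ω) (fun i => y i ω) k z| ≤
          KNN.modulus f z
            ((2 * k / (γ * KNN.densityInf p 𝒳 * KNN.unitBallVolume D * n)) ^ (1 / (D : ℝ)))
          + ENNReal.ofReal
              (2 * σ * Real.sqrt ((D * Real.log n + Real.log (2 / δ)) / k)) := by
  have hlaw : ∀ i, (P.map (x i)).map Subtype.val = KNN.densityMeasure p := fun i =>
    (Measure.map_map measurable_subtype_coe (hx_meas i)).trans (hx_law i)
  have hξ : ∀ i, HasSubgaussianMGF (ξ i) (σ ^ 2) P := fun i =>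
    .of_map (X := fun z => z) (hξ_meas i).aemeasurable ((hξ_law i).symm ▸ hν.2)
  have hvc : KNN.BallVCDimLE 𝒳 (2 * D) :=
    (KNN.ballVCDimLE_finrank_add_one.subtype 𝒳).mono (by simp; omega)
  have ha : 0 < γ * KNN.densityInf p 𝒳 * KNN.unitBallVolume D :=
    mul_pos (mul_pos hreg.1 hp₀) (KNN.unitBallVolume_pos D)
  simpa using theorem1_general (by omega) hvc f (d := D) ha (by exact_mod_cast hD) hreg.2.1
    hx_meas hx_indep
    (fun i => KNN.nullSingletonClass_of_map_coe_eq_densityMeasure hD (hlaw i))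
    (fun i => hp.lowerRegular hreg (hlaw i)) hξ_indep hξ hxξ_indep hy hδ₀ hδ₁ hk hk_lower
    (by simpa [mul_assoc] using hk_upper)
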